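/- **Definitions.** Graphs are simple and finite. For $k\ge 1$ write $[k]=\{1,\dots,k\}$. An *NLC-decomposition tree of width $k$* is a rooted binary tree in which every leaf is labeled $\mathsf{newVertex}_i$ for some $i\in[k]$ (it creates one vertex of color $i$), and every internal node has an ordered pair of children and carries a set $S\subseteq[k]\times[k]$ and a function $R:[k]\to[k]$: from the colored graphs $G'$ and $G''$ constructed at its left and right child it constructs the disjoint union of $G'$ and $G''$, adds an edge between every vertex of color $i$ of $G'$ and every vertex of color $j$ of $G''$ for all $(i,j)\in S$, and then recolors every vertex of color $i$ with $R(i)$, for all $i\in[k]$ simultaneously. (The case $S=\varnothing$ is the disjoint union $\parallel$, and $R=\mathrm{id}$ means no recoloring.) It is a tree of $G$ if the graph constructed at its root is $G$, up to isomorphism. The *NLC-width* of $G$ is the smallest $k$ for which $G$ has an NLC-decomposition tree of width $k$. An *NLC$_+$-decomposition tree of width $k$* is a rooted tree such that (1) every leaf is labeled $\mathsf{newVertex}_i$ for some $i\in[k]$; (2) every internal node is labeled $\Join$ or $\parallel$; (3) every $\Join$ node has exactly two children, which are ordered, and carries a set $S\subseteq[k]\times[k]$ and a function $R:[k]\to[k]$,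 with the same meaning as above; (4) every $\parallel$ node has an arbitrary number, at least two, of children, its colored graph is the disjoint union of those of its children, and, unless it is the root, its parent is a $\Join$ node; (5) for every $\Join$ node, the graph constructed by the subtree rooted at it is connected. The *depth* of a rooted tree is the number of edges of a longest path from the root to a leaf. **Statement.** 1. There is a constant $C$ such that, for every $k\ge1$ and every $n\geq 1$, every connected $n$-vertex graph of NLC-width $k$ has an NLC$_+$-decomposition tree of width at most $k\cdot 2^{k+1}$ and of depth at most $C\log n$. 2. If a connected graph $G$ has an NLC-decomposition tree $T$ of width $w$ and depth $d$, then $G$ has an NLC$_+$-decomposition tree $T_+$ of width $w$ and depth at most $2d$ such that every vertex of $G$ has the same color at the root of $T_+$ as at the root of $T$. -/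

import Mathlib

/-- The operation `⋈_S` on an ordered pair of vertex-disjoint colored graphs `(G, c)`, `(H, d)`:
the disjoint union of `G` and `H`, together with all edges between a vertex of color `i` of `G` and
a vertex of color `j` of `H`, for `(i, j) ∈ S`. -/
def joinGraph {A B : Type} {k : ℕ} (S : Set (Fin k × Fin k))
    (G : SimpleGraph A) (c : A → Fin k) (H : SimpleGraph B) (d : B → Fin k) :
    SimpleGraph (A ⊕ B) where
  Adj
    | Sum.inl a, Sum.inl a' => G.Adj a a'
    | Sum.inr b, Sum.inr b' => H.Adj b b'
    | Sum.inl a, Sum.inr b => (c a, d b) ∈ S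
    | Sum.inr b, Sum.inl a => (c a, d b) ∈ S
  symm := ⟨by
    rintro (a | b) (a' | b') h
    · exact SimpleGraph.Adj.symm h
    · exact h
    · exact h
    · exact SimpleGraph.Adj.symm h⟩
  loopless := ⟨by
    rintro (a | b) h
    · exact G.loopless.irrefl a h
    · exact H.loopless.irrefl b h⟩

/-- The disjoint union of a family of graphs. -/
def parallelGraph {ι : Type} {A : ι → Type} (G : ∀ i, SimpleGraph (A i)) :
    SimpleGraph (Σ i, A i) where
  Adj x y := ∃ i a b, x = ⟨i, a⟩ ∧ y = ⟨i, b⟩ ∧ (G i).Adj a b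
  symm := ⟨by
    rintro x y ⟨i, a, b, hx, hy, h⟩
    exact ⟨i, b, a, hy, hx, SimpleGraph.Adj.symm h⟩⟩
  loopless := ⟨by
    rintro x ⟨i, a, b, hx, hy, h⟩
    have hab : a = b := by simpa using hx.symm.trans hy
    subst hab
    exact (G i).loopless.irrefl a h⟩

/-- NLC-decomposition trees with colors in `[k]`. A leaf creates a vertex with a color; an internal
node has an ordered pair of children, and it performs a join `⋈_S` followed by a recoloring `R`.
The choice `S = ∅` is the label `∥`, and `R = id` means that there is no recoloring. -/
inductive NLCTree (k : ℕ) : Type where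
  | newVertex (i : Fin k) : NLCTree k
  | join (S : Set (Fin k × Fin k)) (R : Fin k → Fin k) (l r : NLCTree k) : NLCTree k

namespace NLCTree

variable {k : ℕ}

/-- The set of leaves of the tree; these are the vertices of the constructed graph. -/
def Leaf : NLCTree k → Type
  | newVertex _ => Unit
  | join _ _ l r => l.Leaf ⊕ r.Leaf

/-- The colors of the vertices at the root of the tree. -/
def color : (T : NLCTree k) → T.Leaf → Fin k
  | newVertex i => fun _ => i
  | join _ R l r => Sum.elim (R ∘ l.color) (R ∘ r.color)

/-- The graph constructed by the tree. -/
def graph : (T : NLCTree k) → SimpleGraph T.Leaf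
  | newVertex _ => (⊥ : SimpleGraph Unit)
  | join S _ l r => joinGraph S l.graph l.color r.graph r.color

/-- The number of edges of a longest path from the root to a leaf. -/
def depth : NLCTree k → ℕ
  | newVertex _ => 0
  | join _ _ l r => max l.depth r.depth + 1

end NLCTree

/-- The NLC-width of a graph: the smallest `k` such that the graph can be constructed, up to
isomorphism, by an NLC-decomposition tree with colors in `[k]`. (Every nonempty finite graph has
such a tree for some `k ≥ 1`; if there is no such tree, then the value is `0`.) -/
noncomputable def nlcWidth {V : Type*} (G : SimpleGraph V) : ℕ :=
  sInf {k | ∃ T : NLCTree k, Nonempty (T.graph ≃g G)}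

/-- Rooted trees with leaves labeled `newVertex i`, binary nodes labeled `⋈` (with a set `S` and a
recoloring function `R`), and nodes labeled `∥` of any arity `p`, all with colors in `[k]`. -/
inductive NLCPlusTree (k : ℕ) : Type where
  | newVertex (i : Fin k) : NLCPlusTree k
  | join (S : Set (Fin k × Fin k)) (R : Fin k → Fin k) (l r : NLCPlusTree k) : NLCPlusTree k
  | parallel (p : ℕ) (child : Fin p → NLCPlusTree k) : NLCPlusTree k

namespace NLCPlusTree

variable {k : ℕ}

/-- The set of leaves of the tree; these are the vertices of the constructed graph. -/
def Leaf : NLCPlusTree k → Type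
  | newVertex _ => Unit
  | join _ _ l r => l.Leaf ⊕ r.Leaf
  | parallel _ child => Σ j, (child j).Leaf

/-- The colors of the vertices at the root of the tree. -/
def color : (T : NLCPlusTree k) → T.Leaf → Fin k
  | newVertex i => fun _ => i
  | join _ R l r => Sum.elim (R ∘ l.color) (R ∘ r.color)
  | parallel _ child => fun x => (child x.1).color x.2

/-- The graph constructed by the tree. -/
def graph : (T : NLCPlusTree k) → SimpleGraph T.Leaf
  | newVertex _ => (⊥ : SimpleGraph Unit)
  | join S _ l r => joinGraph S l.graph l.color r.graph r.color
  | parallel _ child => parallelGraph fun j => (child j).graph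

/-- The number of edges of a longest path from the root to a leaf. -/
def depth : NLCPlusTree k → ℕ
  | newVertex _ => 0
  | join _ _ l r => max l.depth r.depth + 1
  | parallel _ child => (Finset.univ.sup fun j => (child j).depth) + 1

/-- The root of the tree is labeled `∥`. -/
def IsParallel : NLCPlusTree k → Prop
  | parallel _ _ => True
  | _ => False

/-- The conditions that make the tree an NLC₊-decomposition tree of width `k`: every `∥` node has at
least two children, none of which is a `∥` node (so the parent of a `∥` node other than the root is
a `⋈` node), and the graph constructed by the subtree rooted at any `⋈` node is connected. -/
def IsDecomposition : NLCPlusTree k → Prop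
  | newVertex _ => True
  | join S R l r => (join S R l r).graph.Connected ∧ l.IsDecomposition ∧ r.IsDecomposition
  | parallel p child => 2 ≤ p ∧ ∀ j, ¬ (child j).IsParallel ∧ (child j).IsDecomposition

end NLCPlusTree

/-!
For the logarithmic depth, cut a decomposition tree at a node below which roughly half of the
vertices lie. What remains above a node `Q` of the tree is a *context*: in it, a vertex keeps its
color and remembers the set of the colors of its neighbors in `Q`, its *profile*. Since `Q` is built
by a subtree, equally colored vertices of `Q` have the same neighbors outside of `Q`, so color and
profile suffice to plug `Q` back in by a single join. This takes `k * 2 ^ k` colors, and a second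
copy of each lets a join recolor its two sides independently. Trees and contexts are halved
simultaneously, and each doubling of the size costs three levels.

For the conversion into an NLC₊-tree, restrict every join node to the connected components of its
graph. A component that lies in one child needs no new node. A component that meets both children is
a join of its two intersections with them, and each intersection is the disjoint union of components
of the graph of the child; one `∥` node per child gathers these, which doubles the depth.
-/

section

variable {V κ κ' : Type*} {G : SimpleGraph V}

/-- A set of vertices of an ambient graph together with a coloring. It stands for the subgraph
induced on the set. The coloring is a total function, whose values outside of the set are
irrelevant. -/
structure ColoredSet (V κ : Type*) where
  verts : Set V
  color : V → κ

/-- The colored set in which every color `i` is replaced by `φ i`. -/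
def ColoredSet.map (φ : κ → κ') (P : ColoredSet V κ) : ColoredSet V κ' :=
  ⟨P.verts, φ ∘ P.color⟩

/-- `P` arises from `L` and `R` by the operation `⋈_S`, after which the vertices of `L` are
recolored by `f` and those of `R` by `g`. The join nodes of decomposition trees have `f = g`. -/
structure IsJoin (G : SimpleGraph V) (S : Set (κ × κ)) (f g : κ → κ) (P L R : ColoredSet V κ) :
    Prop where
  disjoint : Disjoint L.verts R.verts
  verts_eq : P.verts = L.verts ∪ R.verts
  adj_iff : ∀ x ∈ L.verts, ∀ y ∈ R.verts, G.Adj x y ↔ (L.color x, R.color y) ∈ S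
  color_left : L.verts.EqOn P.color (f ∘ L.color)
  color_right : R.verts.EqOn P.color (g ∘ R.color)

namespace IsJoin

variable {S : Set (κ × κ)} {f g : κ → κ} {P Q L R : ColoredSet V κ}

theorem left_subset (h : IsJoin G S f g P L R) : L.verts ⊆ P.verts :=
  h.verts_eq ▸ Set.subset_union_left

theorem right_subset (h : IsJoin G S f g P L R) : R.verts ⊆ P.verts :=
  h.verts_eq ▸ Set.subset_union_right

theorem sdiff_left (h : IsJoin G S f g P L R) : P.verts \ L.verts = R.verts := by
  rw [h.verts_eq, Set.union_sdiff_cancel_left h.disjoint.le_bot]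

theorem symm (h : IsJoin G S f g P L R) : IsJoin G (Prod.swap ⁻¹' S) g f P R L where
  disjoint := h.disjoint.symm
  verts_eq := h.verts_eq.trans (Set.union_comm _ _)
  adj_iff x hx y hy := (G.adj_comm x y).trans (h.adj_iff y hy x hx)
  color_left := h.color_right
  color_right := h.color_left

theorem recolor {φ : κ → κ} (h : IsJoin G S f g P L R) (hverts : Q.verts = P.verts)
    (hcolor : P.verts.EqOn Q.color (φ ∘ P.color)) : IsJoin G S (φ ∘ f) (φ ∘ g) Q L R where
  disjoint := h.disjoint
  verts_eq := hverts.trans h.verts_eq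
  adj_iff := h.adj_iff
  color_left _ hx := (hcolor (h.left_subset hx)).trans (congrArg φ (h.color_left hx))
  color_right _ hx := (hcolor (h.right_subset hx)).trans (congrArg φ (h.color_right hx))

theorem map {φ : κ → κ'} (h : IsJoin G S f g P L R) (hφ : φ.Injective) :
    IsJoin G (Prod.map φ φ '' S) (Function.extend φ (φ ∘ f) id) (Function.extend φ (φ ∘ g) id)
      (P.map φ) (L.map φ) (R.map φ) where
  disjoint := h.disjoint
  verts_eq := h.verts_eq
  adj_iff x hx y hy := (h.adj_iff x hx y hy).trans
    ((hφ.prodMap hφ).mem_set_image (a := (L.color x, R.color y))).symm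
  color_left x hx :=
    (congrArg φ (h.color_left hx)).trans (hφ.extend_apply (φ ∘ f) id (L.color x)).symm
  color_right x hx :=
    (congrArg φ (h.color_right hx)).trans (hφ.extend_apply (φ ∘ g) id (R.color x)).symm

/-- With two copies of every color, one for each side, a single function can recolor the two sides
independently. -/
theorem tag (h : IsJoin G S f g P L R) :
    IsJoin G (Prod.map Prod.snd Prod.snd ⁻¹' S) (fun i => (false, bif i.1 then g i.2 else f i.2))
      (fun i => (false, bif i.1 then g i.2 else f i.2))
      (P.map (Prod.mk false)) (L.map (Prod.mk false)) (R.map (Prod.mk true)) where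
  disjoint := h.disjoint
  verts_eq := h.verts_eq
  adj_iff := h.adj_iff
  color_left _ hx := congrArg (Prod.mk false) (h.color_left hx)
  color_right _ hx := congrArg (Prod.mk false) (h.color_right hx)

end IsJoin

/-- The colored set is constructed by an NLC-decomposition tree of depth at most `d`, with colors
in `κ`. -/
inductive Built (G : SimpleGraph V) : ℕ → ColoredSet V κ → Prop
  | single (d : ℕ) (v : V) (c : V → κ) : Built G d ⟨{v}, c⟩
  | join {d : ℕ} {S : Set (κ × κ)} {f : κ → κ} {P L R : ColoredSet V κ}
      (h : IsJoin G S f f P L R) (hL : Built G d L) (hR : Built G d R) : Built G (d + 1) P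

namespace Built

variable {d d' : ℕ} {P Q : ColoredSet V κ}

theorem mono (h : Built G d P) (hd : d ≤ d') : Built G d' P := by
  induction h generalizing d' with
  | single => exact single _ _ _
  | join h _ _ ihL ihR =>
    obtain ⟨e, rfl⟩ := Nat.exists_eq_add_of_le' (Nat.one_le_of_lt hd)
    exact join h (ihL (Nat.le_of_succ_le_succ hd)) (ihR (Nat.le_of_succ_le_succ hd))

theorem nonempty (h : Built G d P) : P.verts.Nonempty := by
  induction h with
  | single _ v _ => exact Set.singleton_nonempty v
  | join h _ _ ihL _ => exact ihL.mono h.left_subset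

theorem finite (h : Built G d P) : P.verts.Finite := by
  induction h with
  | single _ v _ => exact Set.finite_singleton v
  | join h _ _ ihL ihR => exact h.verts_eq ▸ ihL.union ihR

theorem recolor {φ : κ → κ} (h : Built G d P) (hverts : Q.verts = P.verts)
    (hcolor : P.verts.EqOn Q.color (φ ∘ P.color)) : Built G d Q := by
  cases h with
  | single _ v _ =>
    obtain ⟨_, c⟩ := Q
    obtain rfl : _ = {v} := hverts
    exact single _ _ _
  | join h hL hR => exact join (h.recolor hverts hcolor) hL hR

theorem map {φ : κ → κ'} (h : Built G d P) (hφ : φ.Injective) : Built G d (P.map φ) := by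
  induction h with
  | single => exact single _ _ _
  | join h _ _ ihL ihR => exact join (h.map hφ) ihL ihR

end Built

/-- The graph `H`, colored by `col`, is isomorphic to the subgraph of `G` induced on `P`, with its
coloring. -/
def Realizes {X : Type*} (G : SimpleGraph V) (H : SimpleGraph X) (col : X → κ)
    (P : ColoredSet V κ) : Prop :=
  ∃ e : H ↪g G, Set.range e = P.verts ∧ P.color ∘ e = col

namespace Realizes

theorem singleton (G : SimpleGraph V) (v : V) (c : V → κ) :
    Realizes G (⊥ : SimpleGraph Unit) (fun _ => c v) ⟨{v}, c⟩ :=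
  ⟨⟨⟨fun _ => v, fun _ _ _ => rfl⟩, by simp⟩, Set.range_const, rfl⟩

theorem connected {X : Type*} {H : SimpleGraph X} {col : X → κ} {P : ColoredSet V κ}
    (h : Realizes G H col P) (hP : (G.induce P.verts).Connected) : H.Connected := by
  obtain ⟨e, he, -⟩ := h
  rw [← he] at hP
  let φ : H ≃g G.induce (Set.range e) := ⟨Equiv.ofInjective e e.injective, e.map_adj_iff⟩
  exact φ.connected_iff.2 hP

theorem of_iso {X : Type*} {H : SimpleGraph X} (col : X → κ) (e : H ≃g G) :
    Realizes G H col ⟨Set.univ, col ∘ e.symm⟩ :=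
  ⟨e.toEmbedding, e.surjective.range_eq, funext fun x => congrArg col (e.symm_apply_apply x)⟩

theorem exists_iso {X : Type*} {H : SimpleGraph X} {col : X → κ} {c : V → κ}
    (h : Realizes G H col ⟨Set.univ, c⟩) : ∃ e : H ≃g G, ∀ v, col (e.symm v) = c v := by
  obtain ⟨e, he, rfl⟩ := h
  let φ : H ≃g G := RelIso.ofSurjective e (Set.range_eq_univ.1 he)
  exact ⟨φ, fun v => congrArg c (φ.apply_symm_apply v)⟩

section Join

variable {X Y : Type} {H : SimpleGraph X} {K : SimpleGraph Y} {k : ℕ} {c : X → Fin k}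
  {d : Y → Fin k} {S : Set (Fin k × Fin k)} {f : Fin k → Fin k} {P L R : ColoredSet V (Fin k)}

theorem join (hL : Realizes G H c L) (hR : Realizes G K d R) (h : IsJoin G S f f P L R) :
    Realizes G (joinGraph S H c K d) (Sum.elim (f ∘ c) (f ∘ d)) P := by
  obtain ⟨e, he, rfl⟩ := hL
  obtain ⟨e', he', rfl⟩ := hR
  have hmem (x : X) : e x ∈ L.verts := he ▸ Set.mem_range_self x
  have hmem' (y : Y) : e' y ∈ R.verts := he' ▸ Set.mem_range_self y
  refine ⟨⟨⟨Sum.elim e e', ?_⟩, ?_⟩, ?_, ?_⟩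
  · exact e.injective.sumElim e'.injective fun x y => h.disjoint.ne_of_mem (hmem x) (hmem' y)
  · rintro (x | x) (y | y)
    · exact e.map_adj_iff
    · exact h.adj_iff _ (hmem x) _ (hmem' y)
    · exact h.symm.adj_iff _ (hmem' x) _ (hmem y)
    · exact e'.map_adj_iff
  · exact (Set.Sum.elim_range e e').trans (by rw [he, he', h.verts_eq])
  · ext (x | y) : 1
    · exact h.color_left (hmem x)
    · exact h.color_right (hmem' y)

theorem exists_isJoin (h : Realizes G (joinGraph S H c K d) (Sum.elim (f ∘ c) (f ∘ d)) P) :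
    ∃ L R, IsJoin G S f f P L R ∧ Realizes G H c L ∧ Realizes G K d R := by
  obtain ⟨e, he, hcol⟩ := h
  let eL : H ↪g G := e.comp ⟨⟨Sum.inl, Sum.inl_injective⟩, Iff.rfl⟩
  let eR : K ↪g G := e.comp ⟨⟨Sum.inr, Sum.inr_injective⟩, Iff.rfl⟩
  have hL (x : X) : Function.extend eL c P.color (eL x) = c x := eL.injective.extend_apply _ _ x
  have hR (y : Y) : Function.extend eR d P.color (eR y) = d y := eR.injective.extend_apply _ _ y
  refine ⟨⟨Set.range eL, Function.extend eL c P.color⟩,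
    ⟨Set.range eR, Function.extend eR d P.color⟩,
    ⟨?_, ?_, ?_, ?_, ?_⟩, ⟨eL, rfl, funext hL⟩, ⟨eR, rfl, funext hR⟩⟩
  · rw [Set.disjoint_left]
    rintro _ ⟨x, rfl⟩ ⟨y, hy⟩
    exact Sum.inr_ne_inl (e.injective hy)
  · rw [← he, ← Set.Sum.elim_range]
    exact congrArg Set.range (Sum.elim_comp_inl_inr e).symm
  · rintro _ ⟨x, rfl⟩ _ ⟨y, rfl⟩
    change G.Adj (eL x) (eR y) ↔
      (Function.extend eL c P.color (eL x), Function.extend eR d P.color (eR y)) ∈ S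
    rw [hL, hR]
    exact e.map_adj_iff (v := Sum.inl x) (w := Sum.inr y)
  · rintro _ ⟨x, rfl⟩
    exact (congrFun hcol (Sum.inl x)).trans (congrArg f (hL x).symm)
  · rintro _ ⟨y, rfl⟩
    exact (congrFun hcol (Sum.inr y)).trans (congrArg f (hR y).symm)

end Join

theorem parallel {ι : Type} {X : ι → Type} {H : ∀ i, SimpleGraph (X i)} {col : ∀ i, X i → κ}
    {A : ι → Set V} {c : V → κ} (h : ∀ i, Realizes G (H i) (col i) ⟨A i, c⟩)
    (hA : Pairwise fun i j => ∀ x ∈ A i, ∀ y ∈ A j, x ≠ y ∧ ¬ G.Adj x y) :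
    Realizes G (parallelGraph H) (fun x => col x.1 x.2) ⟨⋃ i, A i, c⟩ := by
  choose e he hcol using h
  have hmem (i : ι) (x : X i) : e i x ∈ A i :=
    (he i).subset (Set.mem_range_self x)
  refine ⟨⟨⟨fun x => e x.1 x.2, ?_⟩, ?_⟩, ?_, funext fun x => congrFun (hcol x.1) x.2⟩
  · rintro ⟨i, x⟩ ⟨j, y⟩ hxy
    obtain rfl : i = j := of_not_not fun hij => (hA hij _ (hmem i x) _ (hmem j y)).1 hxy
    exact congrArg (Sigma.mk i) ((e i).injective hxy)
  · rintro ⟨i, x⟩ ⟨j, y⟩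
    refine ⟨fun hxy => ?_, ?_⟩
    · obtain rfl : i = j := of_not_not fun hij => (hA hij _ (hmem i x) _ (hmem j y)).2 hxy
      exact ⟨i, x, y, rfl, rfl, (e i).map_adj_iff.1 hxy⟩
    · rintro ⟨l, a, b, hx, hy, hab⟩
      cases hx
      cases hy
      exact (e i).map_adj_iff.2 hab
  · rw [Set.range_sigma_eq_iUnion_range]
    exact Set.iUnion_congr he

end Realizes

theorem NLCTree.built {k : ℕ} (T : NLCTree k) {P : ColoredSet V (Fin k)}
    (h : Realizes G T.graph T.color P) : Built G T.depth P := by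
  induction T generalizing P with
  | newVertex i =>
    obtain ⟨A, c⟩ := P
    obtain ⟨e, rfl : Set.range e = A, -⟩ := h
    have hrange : Set.range e = {e ()} :=
      Set.ext fun _ => ⟨fun ⟨(), hx⟩ => hx.symm, fun hx => ⟨(), hx.symm⟩⟩
    rw [hrange]
    exact .single _ _ _
  | join S f l r ihl ihr =>
    obtain ⟨L, R, hjoin, hL, hR⟩ := h.exists_isJoin
    exact .join hjoin ((ihl hL).mono (le_max_left _ _)) ((ihr hR).mono (le_max_right _ _))

/-- The set of the colors of the neighbors of `x` in `Q`. -/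
def profile (G : SimpleGraph V) (Q : ColoredSet V κ) (x : V) : Set κ :=
  Q.color '' (Q.verts ∩ G.neighborSet x)

/-- The vertices of `P` outside of `Q`, each colored by its color in `P` and its profile with
respect to `Q`. -/
def context (G : SimpleGraph V) (P Q : ColoredSet V κ) : ColoredSet V (κ × Set κ) :=
  ⟨P.verts \ Q.verts, fun x => (P.color x, profile G Q x)⟩

/-- `Q` is contained in `P`, its coloring refines that of `P`, and each of its color classes is a
module: a vertex of `P` outside of `Q` does not distinguish vertices of `Q` of equal color. -/
structure IsModularPart (G : SimpleGraph V) (P Q : ColoredSet V κ) : Prop where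
  subset : Q.verts ⊆ P.verts
  color : ∃ f : κ → κ, Q.verts.EqOn P.color (f ∘ Q.color)
  adj : ∀ x ∈ P.verts \ Q.verts, ∀ y ∈ Q.verts, ∀ z ∈ Q.verts, Q.color y = Q.color z →
    G.Adj x y → G.Adj x z

namespace IsModularPart

variable {P Q D : ColoredSet V κ}

theorem refl (G : SimpleGraph V) (P : ColoredSet V κ) : IsModularPart G P P :=
  ⟨subset_rfl, ⟨id, fun _ _ => rfl⟩, fun _ hx => absurd hx.1 hx.2⟩

theorem empty (G : SimpleGraph V) (P : ColoredSet V κ) (c : V → κ) : IsModularPart G P ⟨∅, c⟩ :=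
  ⟨Set.empty_subset _, ⟨id, fun _ h => h.elim⟩, fun _ _ _ h => h.elim⟩

theorem trans (h : IsModularPart G P Q) (h' : IsModularPart G Q D) : IsModularPart G P D := by
  obtain ⟨f, hf⟩ := h.color
  obtain ⟨g, hg⟩ := h'.color
  refine ⟨h'.subset.trans h.subset,
    ⟨f ∘ g, fun y hy => (hf (h'.subset hy)).trans (congrArg f (hg hy))⟩,
    fun x hx y hy z hz hyz hxy => ?_⟩
  by_cases hxQ : x ∈ Q.verts
  · exact h'.adj x ⟨hxQ, hx.2⟩ y hy z hz hyz hxy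
  · have hQ : Q.color y = Q.color z := by rw [hg hy, hg hz, Function.comp, hyz, Function.comp]
    exact h.adj x ⟨hx.1, hxQ⟩ y (h'.subset hy) z (h'.subset hz) hQ hxy

theorem color_mem_profile_iff (h : IsModularPart G P Q) {x y : V} (hx : x ∈ P.verts \ Q.verts)
    (hy : y ∈ Q.verts) : Q.color y ∈ profile G Q x ↔ G.Adj x y :=
  ⟨fun ⟨z, ⟨hz, hxz⟩, hzy⟩ => h.adj x hx z hz y hy hzy hxz, fun hxy => ⟨y, ⟨hy, hxy⟩, rfl⟩⟩

theorem profile_eq (h : IsModularPart G P Q) (hD : D.verts ⊆ Q.verts) {g : κ → κ}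
    (hg : D.verts.EqOn Q.color (g ∘ D.color)) {x : V} (hx : x ∈ P.verts \ Q.verts) :
    profile G D x = D.color '' D.verts ∩ g ⁻¹' profile G Q x := by
  have hiff {y : V} (hy : y ∈ D.verts) : g (D.color y) ∈ profile G Q x ↔ G.Adj x y := by
    rw [← h.color_mem_profile_iff hx (hD hy), hg hy, Function.comp]
  ext i
  constructor
  · rintro ⟨y, ⟨hy, hxy⟩, rfl⟩
    exact ⟨⟨y, hy, rfl⟩, (hiff hy).2 hxy⟩
  · rintro ⟨⟨y, hy, rfl⟩, hi⟩
    exact ⟨y, ⟨hy, (hiff hy).1 hi⟩, rfl⟩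

theorem isJoin_context (h : IsModularPart G P Q) (h' : IsModularPart G Q D) :
    ∃ f g, IsJoin G {p | p.2.1 ∈ p.1.2} f g (context G P D) (context G P Q) (context G Q D) := by
  obtain ⟨f, hf⟩ := h.color
  obtain ⟨g, hg⟩ := h'.color
  refine ⟨fun p => (p.1, D.color '' D.verts ∩ g ⁻¹' p.2), fun p => (f p.1, p.2), ?_, ?_, ?_, ?_, ?_⟩
  · exact Set.disjoint_left.2 fun x hx hx' => hx.2 hx'.1
  · exact (Set.sdiff_union_sdiff_cancel h.subset h'.subset).symm
  · exact fun x hx y hy => (h.color_mem_profile_iff hx hy.1).symm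
  · exact fun x hx => Prod.ext rfl (h.profile_eq h'.subset hg hx)
  · exact fun x hx => Prod.ext (hf hx.1) rfl

end IsModularPart

namespace IsJoin

variable {S : Set (κ × κ)} {f g : κ → κ} {P L R : ColoredSet V κ}

theorem isModularPart (h : IsJoin G S f g P L R) : IsModularPart G P L := by
  refine ⟨h.left_subset, ⟨f, h.color_left⟩, fun x hx y hy z hz hyz => ?_⟩
  rw [h.sdiff_left] at hx
  rw [h.symm.adj_iff x hx y hy, h.symm.adj_iff x hx z hz, hyz]
  exact id

theorem profile_eq (h : IsJoin G S f g P L R) {x : V} (hx : x ∈ R.verts) :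
    profile G L x = {i ∈ L.color '' L.verts | (i, R.color x) ∈ S} := by
  ext i
  constructor
  · rintro ⟨y, ⟨hy, hxy⟩, rfl⟩
    exact ⟨⟨y, hy, rfl⟩, (h.symm.adj_iff x hx y hy).1 hxy⟩
  · rintro ⟨⟨y, hy, rfl⟩, hi⟩
    exact ⟨y, ⟨hy, (h.symm.adj_iff x hx y hy).2 hi⟩, rfl⟩

end IsJoin

/-- The colored set is empty, or it is constructed by an NLC-decomposition tree of depth at most
`m` with two copies `(false, i)` and `(true, i)` of every color `i`, of which the root uses the
first. -/
def TaggedBuilt (G : SimpleGraph V) (m : ℕ) (P : ColoredSet V κ) : Prop :=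
  P.verts = ∅ ∨ Built G m (P.map (Prod.mk false))

namespace TaggedBuilt

variable {m m' : ℕ} {P Q L R D : ColoredSet V κ}

theorem mono (h : TaggedBuilt G m P) (hm : m ≤ m') : TaggedBuilt G m' P :=
  h.imp_right fun h => h.mono hm

theorem recolor {φ : κ → κ} (h : TaggedBuilt G m P) (hverts : Q.verts = P.verts)
    (hcolor : P.verts.EqOn Q.color (φ ∘ P.color)) : TaggedBuilt G m Q :=
  h.imp hverts.trans fun h => h.recolor (φ := Prod.map id φ) hverts
    fun _ hx => congrArg (Prod.mk false) (hcolor hx)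

theorem of_encard_le_one (h : P.verts.encard ≤ 1) : TaggedBuilt G m P := by
  obtain ⟨A, c⟩ := P
  rcases (Set.encard_le_one_iff_subsingleton.1 h).eq_empty_or_singleton with h | ⟨v, rfl⟩
  · exact .inl h
  · exact .inr (.single _ _ _)

theorem join {S : Set (κ × κ)} {f g : κ → κ} (hL : TaggedBuilt G m L) (hR : TaggedBuilt G m R)
    (h : IsJoin G S f g P L R) : TaggedBuilt G (m + 1) P := by
  rcases hL with hL | hL
  · have hverts : P.verts = R.verts := by rw [h.verts_eq, hL, Set.empty_union]
    exact (hR.recolor hverts h.color_right).mono m.le_succ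
  rcases hR with hR | hR
  · have hverts : P.verts = L.verts := by rw [h.verts_eq, hR, Set.union_empty]
    exact (recolor (.inr hL) hverts h.color_left).mono m.le_succ
  have hR' : Built G m (R.map (Prod.mk true)) :=
    hR.recolor (φ := Prod.map (fun _ => true) id) rfl fun _ _ => rfl
  exact .inr (.join h.tag hL hR')

theorem context_trans (h : TaggedBuilt G m (context G P Q)) (h' : TaggedBuilt G m (context G Q D))
    (hPQ : IsModularPart G P Q) (hQD : IsModularPart G Q D) :
    TaggedBuilt G (m + 1) (context G P D) :=
  let ⟨_, _, hjoin⟩ := hPQ.isJoin_context hQD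
  h.join h' hjoin

variable {S : Set (κ × κ)} {f g : κ → κ} {c : V → κ}

theorem context_left (hR : TaggedBuilt G m (context G R ⟨∅, c⟩)) (h : IsJoin G S f g P L R) :
    TaggedBuilt G m (context G P L) :=
  hR.recolor (φ := fun i => (g i.1, {j ∈ L.color '' L.verts | (j, i.1) ∈ S}))
    (h.sdiff_left.trans Set.sdiff_empty.symm)
    fun _ hx => Prod.ext (h.color_right hx.1) (h.profile_eq hx.1)

theorem context_join (hL : TaggedBuilt G m (context G L ⟨∅, c⟩))
    (hR : TaggedBuilt G m (context G R ⟨∅, c⟩)) (h : IsJoin G S f g P L R) :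
    TaggedBuilt G (m + 1) (context G P ⟨∅, c⟩) :=
  (hR.context_left h).context_trans hL h.isModularPart (.empty _ _ _)

end TaggedBuilt

/-- `P` is constructed by a decomposition tree that has a subtree constructing `Q`. The tree above
the subtree is a path of join nodes, each with one more subtree. -/
inductive BuiltFrom (G : SimpleGraph V) (Q : ColoredSet V κ) : ColoredSet V κ → Prop
  | refl : BuiltFrom G Q Q
  | join {d : ℕ} {S : Set (κ × κ)} {f : κ → κ} {P L R : ColoredSet V κ}
      (h : IsJoin G S f f P L R) (hL : BuiltFrom G Q L) (hR : Built G d R) : BuiltFrom G Q P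

theorem BuiltFrom.isModularPart {P Q : ColoredSet V κ} (h : BuiltFrom G Q P) :
    IsModularPart G P Q := by
  induction h with
  | refl => exact .refl _ _
  | join h _ _ ih => exact h.isModularPart.trans ih

theorem Built.exists_heavy {d n : ℕ} {P : ColoredSet V κ} (h : Built G d P) (hn : 1 ≤ n)
    (hP : n < P.verts.encard) :
    ∃ e S f U L R, BuiltFrom G U P ∧ IsJoin G S f f U L R ∧ Built G e L ∧ Built G e R ∧
      n < U.verts.encard ∧ L.verts.encard ≤ n ∧ R.verts.encard ≤ n := by
  induction h with
  | single =>
    rw [Set.encard_singleton] at hP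
    exact absurd hP (not_lt.2 (mod_cast hn))
  | @join d S f P L R h hL hR ihL ihR =>
    by_cases hLn : n < L.verts.encard
    · obtain ⟨e, S', f', U, L', R', hU, hrest⟩ := ihL hLn
      exact ⟨e, S', f', U, L', R', .join h hU hR, hrest⟩
    by_cases hRn : n < R.verts.encard
    · obtain ⟨e, S', f', U, L', R', hU, hrest⟩ := ihR hRn
      exact ⟨e, S', f', U, L', R', .join h.symm hU hL, hrest⟩
    exact ⟨d, S, f, P, L, R, .refl, h, hL, hR, hP, not_lt.1 hLn, not_lt.1 hRn⟩

theorem BuiltFrom.exists_heavy {n : ℕ} {P Q : ColoredSet V κ} (h : BuiltFrom G Q P)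
    (hP : n < (P.verts \ Q.verts).encard) :
    ∃ e S f U L R, BuiltFrom G U P ∧ IsJoin G S f f U L R ∧ BuiltFrom G Q L ∧ Built G e R ∧
      n < (U.verts \ Q.verts).encard ∧ (L.verts \ Q.verts).encard ≤ n := by
  induction h with
  | refl => simp at hP
  | @join d S f P L R h hL hR ih =>
    by_cases hLn : n < (L.verts \ Q.verts).encard
    · obtain ⟨e, S', f', U, L', R', hU, hrest⟩ := ih hLn
      exact ⟨e, S', f', U, L', R', .join h hU hR, hrest⟩
    exact ⟨d, S, f, P, L, R, .refl, h, hL, hR, hP, not_lt.1 hLn⟩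

theorem encard_sdiff_le_of_lt_encard_sdiff {α : Type*} {A B U : Set α} {n : ℕ} (hBU : B ⊆ U)
    (hUA : U ⊆ A) (hA : (A \ B).encard ≤ (2 * n : ℕ)) (hU : n < (U \ B).encard) :
    (A \ U).encard ≤ n := by
  have hadd : (A \ U).encard + (U \ B).encard = (A \ B).encard := by
    rw [← Set.sdiff_union_sdiff_cancel hUA hBU,
      Set.encard_union_eq (Set.disjoint_left.2 fun x hx hx' => hx.2 hx'.1)]
  rw [← hadd] at hA
  have hfin := hA.trans_lt (ENat.natCast_lt_top _)
  lift (A \ U).encard to ℕ using (le_self_add.trans_lt hfin).ne with a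
  lift (U \ B).encard to ℕ using (le_add_self.trans_lt hfin).ne with u
  norm_cast at hA hU ⊢
  omega

/-- Every colored set with at most `n` vertices that is constructed by a decomposition tree is
constructed by one of depth at most `m`, as a context. The coloring `c` of the empty set is
immaterial. -/
def TreesBalanced (G : SimpleGraph V) (c : V → κ) (n m : ℕ) : Prop :=
  ∀ ⦃d : ℕ⦄ ⦃P : ColoredSet V κ⦄, Built G d P → P.verts.encard ≤ n →
    TaggedBuilt G m (context G P ⟨∅, c⟩)

/-- Every context with at most `n` vertices of a subtree in a decomposition tree is constructed by
a tree of depth at most `m`. -/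
def ContextsBalanced (κ : Type*) (G : SimpleGraph V) (n m : ℕ) : Prop :=
  ∀ ⦃P Q : ColoredSet V κ⦄, BuiltFrom G Q P → (P.verts \ Q.verts).encard ≤ n →
    TaggedBuilt G m (context G P Q)

theorem TreesBalanced.double {c : V → κ} {n m : ℕ} (htree : TreesBalanced G c n m)
    (hcontext : ContextsBalanced κ G n (m + 2)) (hn : 1 ≤ n) :
    TreesBalanced G c (2 * n) (m + 3) := by
  intro d P hP hcard
  by_cases hle : P.verts.encard ≤ n
  · exact (htree hP hle).mono (by omega)
  obtain ⟨e, S, f, U, L, R, hPU, hjoin, hL, hR, hUn, hLn, hRn⟩ := hP.exists_heavy hn (not_le.1 hle)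
  have hupper : TaggedBuilt G (m + 2) (context G P U) :=
    hcontext hPU (encard_sdiff_le_of_lt_encard_sdiff (Set.empty_subset _) hPU.isModularPart.subset
      (by simpa using hcard) (by simpa using hUn))
  have hlower : TaggedBuilt G (m + 1) (context G U ⟨∅, c⟩) :=
    (htree hL hLn).context_join (htree hR hRn) hjoin
  exact hupper.context_trans (hlower.mono (by omega)) hPU.isModularPart (.empty _ _ _)

theorem ContextsBalanced.double {c : V → κ} {n m : ℕ} (hcontext : ContextsBalanced κ G n m)
    (htree : TreesBalanced G c (2 * n) (m + 1)) : ContextsBalanced κ G (2 * n) (m + 3) := by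
  intro P Q hPQ hcard
  by_cases hle : (P.verts \ Q.verts).encard ≤ n
  · exact (hcontext hPQ hle).mono (by omega)
  obtain ⟨e, S, f, U, L, R, hPU, hjoin, hLQ, hR, hUn, hLn⟩ := hPQ.exists_heavy (not_le.1 hle)
  have hUQ : IsModularPart G U Q := hjoin.isModularPart.trans hLQ.isModularPart
  have hupper : TaggedBuilt G m (context G P U) :=
    hcontext hPU (encard_sdiff_le_of_lt_encard_sdiff hUQ.subset hPU.isModularPart.subset hcard hUn)
  have hRPQ : R.verts ⊆ P.verts \ Q.verts := fun x hx =>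
    ⟨hPU.isModularPart.subset (hjoin.right_subset hx),
      fun hxQ => hjoin.disjoint.ne_of_mem (hLQ.isModularPart.subset hxQ) hx rfl⟩
  have hside : TaggedBuilt G (m + 1) (context G U L) :=
    (htree hR ((Set.encard_le_encard hRPQ).trans hcard)).context_left hjoin
  have hlower : TaggedBuilt G (m + 2) (context G U Q) :=
    hside.context_trans ((hcontext hLQ hLn).mono (by omega)) hjoin.isModularPart hLQ.isModularPart
  exact (hupper.mono (by omega)).context_trans hlower hPU.isModularPart hUQ

theorem treesBalanced_and_contextsBalanced (G : SimpleGraph V) (c : V → κ) (h : ℕ) :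
    TreesBalanced G c (2 ^ h) (3 * h) ∧ ContextsBalanced κ G (2 ^ h) (3 * h + 2) := by
  induction h with
  | zero =>
    refine ⟨fun d P _ hP => .of_encard_le_one ?_, fun P Q _ hPQ => .of_encard_le_one ?_⟩
    · simpa [context] using hP
    · simpa [context] using hPQ
  | succ h ih =>
    have htree := ih.1.double ih.2 Nat.one_le_two_pow
    rw [pow_succ', mul_add]
    exact ⟨htree, ih.2.double htree⟩

theorem Built.exists_depth_le_clog [Finite V] {k d : ℕ} {a : V → Fin k}
    (h : Built G d ⟨Set.univ, a⟩) :
    ∃ c : V → Fin (k * 2 ^ (k + 1)), Built G (3 * Nat.clog 2 (Nat.card V)) ⟨Set.univ, c⟩ := by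
  have huniv : (Set.univ : Set V).encard ≤ (2 ^ Nat.clog 2 (Nat.card V) : ℕ) := by
    rw [Set.encard_univ, ENat.card_eq_coe_natCard]
    exact mod_cast Nat.le_pow_clog one_lt_two _
  have hcontext := ((treesBalanced_and_contextsBalanced G a _).1 h huniv).resolve_left
    (by simpa [context] using h.nonempty.ne_empty)
  have hcard : Nat.card (Bool × Fin k × Set (Fin k)) = k * 2 ^ (k + 1) := by
    simp only [Nat.card_eq_fintype_card, Fintype.card_prod, Fintype.card_bool, Fintype.card_fin,
      Fintype.card_set]
    ring
  have hbuilt := hcontext.map (Finite.equivFinOfCardEq hcard).injective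
  simp only [ColoredSet.map, context, Set.sdiff_empty] at hbuilt
  exact ⟨_, hbuilt⟩

/-- `W` is a union of connected components of the subgraph of `G` induced on `A`. -/
structure IsClosedIn (G : SimpleGraph V) (A W : Set V) : Prop where
  subset : W ⊆ A
  mem_of_adj : ∀ x ∈ W, ∀ y ∈ A, G.Adj x y → y ∈ W

/-- `K` is the vertex set of a connected component of the subgraph of `G` induced on `A`. -/
structure IsComponentOf (G : SimpleGraph V) (A K : Set V) : Prop extends IsClosedIn G A K where
  connected : (G.induce K).Connected

namespace IsClosedIn

variable {A B J W : Set V}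

theorem refl (G : SimpleGraph V) (A : Set V) : IsClosedIn G A A :=
  ⟨subset_rfl, fun _ _ _ hy _ => hy⟩

theorem inter (h : IsClosedIn G A W) (hBA : B ⊆ A) : IsClosedIn G B (W ∩ B) :=
  ⟨Set.inter_subset_right, fun x hx y hy hxy => ⟨h.mem_of_adj x hx.1 y (hBA hy) hxy, hy⟩⟩

theorem component_subset (h : IsClosedIn G A W) (hJ : IsComponentOf G A J) {x : V} (hxJ : x ∈ J)
    (hxW : x ∈ W) : J ⊆ W := by
  intro y hy
  by_contra hyW
  obtain ⟨p⟩ := hJ.connected.preconnected ⟨x, hxJ⟩ ⟨y, hy⟩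
  obtain ⟨e, -, he, he'⟩ := p.exists_boundary_dart (Subtype.val ⁻¹' W) hxW hyW
  exact he' (h.mem_of_adj _ he _ (hJ.subset e.snd.2) e.adj)

end IsClosedIn

namespace IsComponentOf

variable {A B J K : Set V}

theorem exists_mem (G : SimpleGraph V) {x : V} (hx : x ∈ A) : ∃ K, IsComponentOf G A K ∧ x ∈ K := by
  let C := (G.induce A).connectedComponentMk ⟨x, hx⟩
  refine ⟨Subtype.val '' C.supp, ⟨⟨Subtype.coe_image_subset _ _, ?_⟩, ?_⟩, ⟨⟨x, hx⟩, rfl, rfl⟩⟩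
  · rintro _ ⟨y, hy, rfl⟩ z hz hyz
    exact ⟨⟨z, hz⟩, C.mem_supp_of_adj_mem_supp hy hyz, rfl⟩
  · let φ : (G.induce A).induce C.supp →g G.induce (Subtype.val '' C.supp) :=
      ⟨fun y => ⟨y.1.1, y.1, y.2, rfl⟩, id⟩
    refine SimpleGraph.Connected.map φ ?_ C.connected_toSimpleGraph
    rintro ⟨_, y, hy, rfl⟩
    exact ⟨⟨y, hy⟩, rfl⟩

theorem eq_of_mem (hJ : IsComponentOf G A J) (hK : IsComponentOf G A K) {x : V} (hxJ : x ∈ J)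
    (hxK : x ∈ K) : J = K :=
  (hK.component_subset hJ hxJ hxK).antisymm (hJ.component_subset hK hxK hxJ)

theorem mono (h : IsComponentOf G A K) (hKB : K ⊆ B) (hBA : B ⊆ A) : IsComponentOf G B K :=
  ⟨⟨hKB, fun x hx y hy => h.mem_of_adj x hx y (hBA hy)⟩, h.connected⟩

end IsComponentOf

/-- The colored set is constructed by an NLC₊-decomposition tree of depth at most `d`. -/
def PlusBuilt {k : ℕ} (G : SimpleGraph V) (d : ℕ) (P : ColoredSet V (Fin k)) : Prop :=
  ∃ T : NLCPlusTree k, T.IsDecomposition ∧ T.depth ≤ d ∧ Realizes G T.graph T.color P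

/-- As `PlusBuilt`, with a tree whose root is not labeled `∥`, so that it can be a child of a `∥`
node. -/
def PlusBuiltConnected {k : ℕ} (G : SimpleGraph V) (d : ℕ) (P : ColoredSet V (Fin k)) : Prop :=
  ∃ T : NLCPlusTree k, ¬ T.IsParallel ∧ T.IsDecomposition ∧ T.depth ≤ d ∧
    Realizes G T.graph T.color P

namespace PlusBuiltConnected

variable {k d d' : ℕ} {P Q : ColoredSet V (Fin k)}

theorem mono (h : PlusBuiltConnected G d P) (hd : d ≤ d') : PlusBuiltConnected G d' P :=
  let ⟨T, hroot, hT, hdepth, hP⟩ := h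
  ⟨T, hroot, hT, hdepth.trans hd, hP⟩

theorem plusBuilt (h : PlusBuiltConnected G d P) : PlusBuilt G d P :=
  let ⟨T, _, hT⟩ := h
  ⟨T, hT⟩

theorem singleton (G : SimpleGraph V) (d : ℕ) (v : V) (c : V → Fin k) :
    PlusBuiltConnected G d ⟨{v}, c⟩ :=
  ⟨.newVertex (c v), id, trivial, Nat.zero_le _, .singleton G v c⟩

theorem recolor {φ : Fin k → Fin k} (h : PlusBuiltConnected G d P) (hverts : Q.verts = P.verts)
    (hcolor : P.verts.EqOn Q.color (φ ∘ P.color)) : PlusBuiltConnected G d Q := by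
  obtain ⟨T, hroot, hT, hd, e, he, hcol⟩ := h
  have hcolQ (x : T.Leaf) : Q.color (e x) = φ (T.color x) := by
    rw [hcolor (he ▸ Set.mem_range_self x), ← hcol, Function.comp, Function.comp]
  rw [← hverts] at he
  cases T with
  | newVertex i => exact ⟨.newVertex (φ i), id, trivial, hd, e, he, funext hcolQ⟩
  | join S f l r =>
    refine ⟨.join S (φ ∘ f) l r, id, hT, hd, e, he, ?_⟩
    ext (x | x) : 1
    exacts [hcolQ (.inl x), hcolQ (.inr x)]
  | parallel p child => exact absurd trivial hroot

end PlusBuiltConnected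

namespace PlusBuilt

variable {k d : ℕ}

theorem mono {d' : ℕ} {P : ColoredSet V (Fin k)} (h : PlusBuilt G d P) (hd : d ≤ d') :
    PlusBuilt G d' P :=
  let ⟨T, hT, hdepth, hP⟩ := h
  ⟨T, hT, hdepth.trans hd, hP⟩

theorem join {S : Set (Fin k × Fin k)} {f : Fin k → Fin k} {P L R : ColoredSet V (Fin k)}
    (hL : PlusBuilt G d L) (hR : PlusBuilt G d R) (h : IsJoin G S f f P L R)
    (hP : (G.induce P.verts).Connected) : PlusBuiltConnected G (d + 1) P := by
  obtain ⟨T, hT, hTd, hTL⟩ := hL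
  obtain ⟨U, hU, hUd, hUR⟩ := hR
  have hTU := hTL.join hUR h
  exact ⟨.join S f T U, id, ⟨hTU.connected hP, hT, hU⟩, Nat.succ_le_succ (max_le hTd hUd), hTU⟩

theorem parallel {ι : Type*} [Finite ι] [Nontrivial ι] {A : ι → Set V} {c : V → Fin k}
    (h : ∀ i, PlusBuiltConnected G d ⟨A i, c⟩)
    (hA : Pairwise fun i j => ∀ x ∈ A i, ∀ y ∈ A j, x ≠ y ∧ ¬ G.Adj x y) :
    PlusBuilt G (d + 1) ⟨⋃ i, A i, c⟩ := by
  let φ := Finite.equivFin ι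
  choose T hroot hT hd hreal using fun j => h (φ.symm j)
  rw [← φ.symm.surjective.iUnion_comp]
  exact ⟨.parallel _ T, ⟨Finite.one_lt_card, fun j => ⟨hroot j, hT j⟩⟩,
    Nat.succ_le_succ (Finset.sup_le fun j _ => hd j),
    .parallel hreal fun _ _ hij => hA (φ.symm.injective.ne hij)⟩

theorem of_components {A W : Set V} {c : V → Fin k} (hW : IsClosedIn G A W) (hfin : W.Finite)
    (hne : W.Nonempty) (h : ∀ J, IsComponentOf G A J → PlusBuiltConnected G d ⟨J, c⟩) :
    PlusBuilt G (d + 1) ⟨W, c⟩ := by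
  let ι := {J : Set V // IsComponentOf G A J ∧ J ⊆ W}
  have : Finite ι := (hfin.finite_subsets.subset fun _ hJ => hJ.2).to_subtype
  have hmem {x : V} (hx : x ∈ W) : ∃ J : ι, x ∈ J.1 := by
    obtain ⟨J, hJ, hxJ⟩ := IsComponentOf.exists_mem G (hW.subset hx)
    exact ⟨⟨J, hJ, hW.component_subset hJ hxJ hx⟩, hxJ⟩
  have hunion : W = ⋃ J : ι, J.1 :=
    Set.Subset.antisymm (fun x hx => Set.mem_iUnion.2 (hmem hx))
      (Set.iUnion_subset fun J => J.2.2)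
  have hsep : Pairwise fun I J : ι => ∀ x ∈ I.1, ∀ y ∈ J.1, x ≠ y ∧ ¬ G.Adj x y := by
    refine fun I J hIJ x hx y hy => ⟨?_, fun hxy => ?_⟩
    · rintro rfl
      exact hIJ (Subtype.ext (I.2.1.eq_of_mem J.2.1 hx hy))
    · have hyI := I.2.1.mem_of_adj x hx y (J.2.1.subset hy) hxy
      exact hIJ (Subtype.ext (I.2.1.eq_of_mem J.2.1 hyI hy))
  rcases subsingleton_or_nontrivial ι with _ | _
  · obtain ⟨x, hx⟩ := hne
    obtain ⟨J, -⟩ := hmem hx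
    have : Nonempty ι := ⟨J⟩
    rw [hunion, Set.iUnion_eq_const fun I : ι => congrArg Subtype.val (Subsingleton.elim I J)]
    exact ((h _ J.2.1).mono d.le_succ).plusBuilt
  · rw [hunion]
    exact parallel (fun J => h _ J.2.1) hsep

end PlusBuilt

namespace Built

variable {k d : ℕ}

/-- A join node is restricted to the component `K` of its graph. If `K` meets both children, then
each of them contributes a `∥` node over its components inside `K`, whence the factor `2`. -/
theorem plusBuiltConnected {P : ColoredSet V (Fin k)} {K : Set V} (h : Built G d P)
    (hK : IsComponentOf G P.verts K) : PlusBuiltConnected G (2 * d) ⟨K, P.color⟩ := by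
  induction h generalizing K with
  | single d v c =>
    obtain rfl : K = {v} := (Set.subset_singleton_iff_eq.1 hK.subset).resolve_left
      (Set.nonempty_coe_sort.1 hK.connected.nonempty).ne_empty
    exact .singleton G _ v c
  | @join d S f P L R h hL hR ihL ihR =>
    have hKLR : K ⊆ L.verts ∪ R.verts := h.verts_eq ▸ hK.subset
    by_cases hKL : K ⊆ L.verts
    · have hplus : PlusBuiltConnected G (2 * d) ⟨K, P.color⟩ :=
        (ihL (hK.mono hKL h.left_subset)).recolor (φ := f) rfl fun _ hx => h.color_left (hKL hx)
      exact hplus.mono (by omega)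
    by_cases hKR : K ⊆ R.verts
    · have hplus : PlusBuiltConnected G (2 * d) ⟨K, P.color⟩ :=
        (ihR (hK.mono hKR h.right_subset)).recolor (φ := f) rfl fun _ hx => h.color_right (hKR hx)
      exact hplus.mono (by omega)
    have hneL : (K ∩ L.verts).Nonempty :=
      let ⟨x, hx, hxR⟩ := Set.not_subset.1 hKR
      ⟨x, hx, (hKLR hx).resolve_right hxR⟩
    have hneR : (K ∩ R.verts).Nonempty :=
      let ⟨x, hx, hxL⟩ := Set.not_subset.1 hKL
      ⟨x, hx, (hKLR hx).resolve_left hxL⟩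
    have hjoin : IsJoin G S f f ⟨K, P.color⟩ ⟨K ∩ L.verts, L.color⟩ ⟨K ∩ R.verts, R.color⟩ :=
      ⟨h.disjoint.mono Set.inter_subset_right Set.inter_subset_right,
        by rw [← Set.inter_union_distrib_left, Set.inter_eq_left.2 hKLR],
        fun x hx y hy => h.adj_iff x hx.2 y hy.2,
        h.color_left.mono Set.inter_subset_right, h.color_right.mono Set.inter_subset_right⟩
    exact PlusBuilt.join (d := 2 * d + 1)
      (.of_components (hK.inter h.left_subset) (hL.finite.inter_of_right K) hneL fun _ => ihL)
      (.of_components (hK.inter h.right_subset) (hR.finite.inter_of_right K) hneR fun _ => ihR)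
      hjoin hK.connected

theorem plusBuilt_of_connected {P : ColoredSet V (Fin k)} (h : Built G d P)
    (hP : (G.induce P.verts).Connected) : PlusBuilt G (2 * d) P :=
  (h.plusBuiltConnected ⟨.refl _ _, hP⟩).plusBuilt

theorem plusBuilt {P : ColoredSet V (Fin k)} (h : Built G d P) : PlusBuilt G (2 * d + 1) P :=
  .of_components (.refl _ _) h.finite h.nonempty fun _ => h.plusBuiltConnected

theorem exists_plusBuilt_le_clog [Finite V] {a : V → Fin k} (h : Built G d ⟨Set.univ, a⟩) :
    ∃ c : V → Fin (k * 2 ^ (k + 1)), PlusBuilt G (7 * Nat.clog 2 (Nat.card V)) ⟨Set.univ, c⟩ := by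
  obtain ⟨c, hc⟩ := h.exists_depth_le_clog
  refine ⟨c, ?_⟩
  by_cases hG : (G.induce Set.univ).Connected
  · exact (hc.plusBuilt_of_connected hG).mono (by omega)
  have : Nontrivial V := by
    by_contra hV
    have : Subsingleton V := not_nontrivial_iff_subsingleton.1 hV
    have : Nonempty (Set.univ : Set V) := h.nonempty.to_subtype
    exact hG .of_subsingleton
  have hpos : 0 < Nat.clog 2 (Nat.card V) := Nat.clog_pos one_lt_two Finite.one_lt_card
  exact hc.plusBuilt.mono (by omega)

end Built

theorem clog_two_le_two_mul_logb (n : ℕ) : (Nat.clog 2 n : ℝ) ≤ 2 * Real.logb 2 n := by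
  rcases le_or_gt n 1 with hn | hn
  · interval_cases n <;> simp
  · rw [← Real.natCeil_logb_natCast]
    have hlogb : 1 ≤ Real.logb 2 n := by
      rw [Real.le_logb_iff_rpow_le one_lt_two (by positivity), Real.rpow_one]
      exact_mod_cast hn
    exact Nat.ceil_le_two_mul (by linarith)

theorem exists_nlcPlusTree_depth_le_log [Fintype V] {k : ℕ} (T : NLCTree k) (e : T.graph ≃g G) :
    ∃ T' : NLCPlusTree (k * 2 ^ (k + 1)), T'.IsDecomposition ∧ Nonempty (T'.graph ≃g G) ∧
      (T'.depth : ℝ) ≤ 14 / Real.log 2 * Real.log (Fintype.card V) := by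
  obtain ⟨c, T', hT', hdepth, hreal⟩ := (T.built (.of_iso T.color e)).exists_plusBuilt_le_clog
  obtain ⟨e', -⟩ := hreal.exists_iso
  refine ⟨T', hT', ⟨e'⟩, ?_⟩
  rw [Nat.card_eq_fintype_card] at hdepth
  calc (T'.depth : ℝ) ≤ 7 * Nat.clog 2 (Fintype.card V) := mod_cast hdepth
    _ ≤ 7 * (2 * Real.logb 2 (Fintype.card V)) := by gcongr; exact clog_two_le_two_mul_logb _
    _ = 14 / Real.log 2 * Real.log (Fintype.card V) := by rw [Real.logb]; ring

theorem exists_nlcPlusTree_color_eq {w : ℕ} (T : NLCTree w) (e : T.graph ≃g G) :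
    ∃ T' : NLCPlusTree w, T'.IsDecomposition ∧ T'.depth ≤ 2 * T.depth + 1 ∧
      (G.Connected → T'.depth ≤ 2 * T.depth) ∧
        ∃ e' : T'.graph ≃g G, ∀ v, T'.color (e'.symm v) = T.color (e.symm v) := by
  have hbuilt := T.built (.of_iso T.color e)
  by_cases hG : G.Connected
  · obtain ⟨T', hT', hdepth, hreal⟩ :=
      hbuilt.plusBuilt_of_connected ((SimpleGraph.induceUnivIso G).connected_iff.2 hG)
    exact ⟨T', hT', hdepth.trans (Nat.le_succ _), fun _ => hdepth, hreal.exists_iso⟩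
  · obtain ⟨T', hT', hdepth, hreal⟩ := hbuilt.plusBuilt
    exact ⟨T', hT', hdepth, fun h => absurd h hG, hreal.exists_iso⟩

theorem exists_nlcTree_of_nlcWidth_eq {k : ℕ} (hk : 1 ≤ k) (hw : nlcWidth G = k) :
    ∃ T : NLCTree k, Nonempty (T.graph ≃g G) :=
  hw ▸ Nat.sInf_mem (Nat.nonempty_of_pos_sInf (hk.trans_eq hw.symm))

end

theorem mainTheorem5_general :
    (∃ C : ℝ, ∀ (k : ℕ) (V : Type*) [Fintype V] (G : SimpleGraph V) (T : NLCTree k),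
      T.graph ≃g G → ∃ T' : NLCPlusTree (k * 2 ^ (k + 1)),
        T'.IsDecomposition ∧ Nonempty (T'.graph ≃g G) ∧
          (T'.depth : ℝ) ≤ C * Real.log (Fintype.card V)) ∧
    (∀ (V : Type*) (G : SimpleGraph V) (w : ℕ) (T : NLCTree w) (e : T.graph ≃g G),
      ∃ T' : NLCPlusTree w, T'.IsDecomposition ∧ T'.depth ≤ 2 * T.depth + 1 ∧
        (G.Connected → T'.depth ≤ 2 * T.depth) ∧
          ∃ e' : T'.graph ≃g G, ∀ v : V, T'.color (e'.symm v) = T.color (e.symm v)) :=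
  ⟨⟨_, fun _ _ _ _ => exists_nlcPlusTree_depth_le_log⟩,
    fun _ _ _ => exists_nlcPlusTree_color_eq⟩

theorem mainTheorem5 :
    (∃ C : ℝ, ∀ k : ℕ, 1 ≤ k → ∀ (V : Type*) [Fintype V] (G : SimpleGraph V),
      G.Connected → nlcWidth G = k →
        ∃ w : ℕ, w ≤ k * 2 ^ (k + 1) ∧ ∃ T : NLCPlusTree w,
          T.IsDecomposition ∧ Nonempty (T.graph ≃g G) ∧
            (T.depth : ℝ) ≤ C * Real.log (Fintype.card V)) ∧
    (∀ (V : Type*) (G : SimpleGraph V), G.Connected →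
      ∀ (w : ℕ) (T : NLCTree w) (e : T.graph ≃g G),
        ∃ T' : NLCPlusTree w, T'.IsDecomposition ∧ T'.depth ≤ 2 * T.depth ∧
          ∃ e' : T'.graph ≃g G, ∀ v : V, T'.color (e'.symm v) = T.color (e.symm v)) := by
  obtain ⟨⟨C, hlog⟩, hcolor⟩ := mainTheorem5_general
  refine ⟨⟨C, fun k hk V _ G _ hw => ?_⟩, fun V G hG w T e => ?_⟩
  · obtain ⟨T, ⟨e⟩⟩ := exists_nlcTree_of_nlcWidth_eq hk hw
    exact ⟨_, le_rfl, hlog k V G T e⟩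
  · obtain ⟨T', hT', -, hdepth, he'⟩ := hcolor V G w T e
    exact ⟨T', hT', hdepth hG, he'⟩
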